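/- **Setting.** A constant-sum Colonel Blotto game has $n\ge 3$ battlefields with values $w_i>0$ ($1\le i\le n$) common to both players, budgets $0<X_A\le X_B$ and a tie-breaking parameter $\alpha\in[0,1]$. A pure strategy of player $P\in\{A,B\}$ is a vector $x^P\in\mathbb{R}_{\ge 0}^n$ with $\sum_i x^P_i\le X_P$; a mixed strategy is a probability distribution carried by the set of pure strategies. In battlefield $i$ the player who allocates strictly more gains $w_i$ and the other gains $0$; in case of a tie A gains $\alpha w_i$ and B gains $(1-\alpha)w_i$. The payoffs $\Pi_A,\Pi_B$ are the sums of the gains over all battlefields, extended to mixed strategies (played independently) by expectation. Let $W=\sum_i w_i$ and $v^A_i=v^B_i=w_i/W$. A profile $(s^*,t^*)$ of mixed strategies is an $\eta$-equilibrium if $\Pi_A(s,t^*)\le\Pi_A(s^*,t^*)+\eta$ and $\Pi_B(s^*,t)\le\Pi_B(s^*,t^*)+\eta$ for all mixed strategies $s$ of A and $t$ of B. For $\gamma>0$ let $\Omega_A(\gamma)=\{i: v^A_i/v^B_i>\gamma\}$ and consider the equation $$\frac{X_B\,\gamma}{X_A}=\frac{\gamma^2\sum_{i\in\Omega_A(\gamma)}\frac{(v^B_i)^2}{v^A_i}+\sum_{i\notin\Omega_A(\gamma)}v^A_i}{\sum_{i\in\Omega_A(\gamma)}v^B_i+\frac1{\gamma^2}\sum_{i\notin\Omega_A(\gamma)}\frac{(v^A_i)^2}{v^B_i}}.\qquad(*)$$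 For a positive solution $\gamma$ of $(*)$ put $$\lambda_A=\frac{\gamma^2}{2X_B}\sum_{i\in\Omega_A(\gamma)}\frac{(v^B_i)^2}{v^A_i}+\frac1{2X_B}\sum_{i\notin\Omega_A(\gamma)}v^A_i,\qquad \lambda_B=\frac1{2X_A}\sum_{i\in\Omega_A(\gamma)}v^B_i+\frac1{2\gamma^2X_A}\sum_{i\notin\Omega_A(\gamma)}\frac{(v^A_i)^2}{v^B_i}.$$ Let $a_i=v^A_i/\lambda_A$ and $b_i=v^B_i/\lambda_B$. If $i\in\Omega_A(\gamma)$, let $F_{A,i}$ be the uniform distribution on $[0,b_i]$ and $F_{B,i}$ the distribution with mass $(a_i-b_i)/a_i$ at $0$ and the remaining mass uniform on $[0,b_i]$. If $i\notin\Omega_A(\gamma)$, let $F_{B,i}$ be the uniform distribution on $[0,a_i]$ and $F_{A,i}$ the distribution with mass $(b_i-a_i)/b_i$ at $0$ and the remaining mass uniform on $[0,a_i]$. The independently uniform strategy $\mathrm{IU}^{\gamma}_P$ of player $P$ is the law of the allocation obtained by drawing $z_i\sim F_{P,i}$ independently for $i=1,\dots,n$ and setting $x^P_i=\frac{z_i}{\sum_j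 z_j}X_P$ for all $i$ (and $x^P=0$ if $\sum_j z_j=0$). **Statement.** Fix $0<X_A\le X_B$ and $0<\underline w\le\overline w$. There is a function $\varepsilon:\mathbb{N}\to(0,\infty)$ with $\varepsilon(n)=\tilde{\mathcal O}(n^{-1/2})$, i.e. $\varepsilon(n)=\mathcal O\big(n^{-1/2}(\ln n)^k\big)$ as $n\to\infty$ for some $k\in\mathbb{N}$, such that for every constant-sum Colonel Blotto game with any number $n\ge3$ of battlefields, budgets $X_A,X_B$, any $\alpha\in[0,1]$, and values $w_i\in[\underline w,\overline w]$ for all $i$: 1. $\gamma^*=X_B/X_A$ is the unique positive solution of $(*)$; 2. the profile $(\mathrm{IU}^{\gamma^*}_A,\mathrm{IU}^{\gamma^*}_B)$ is an $\varepsilon(n)W$-equilibrium. -/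

import Mathlib

open MeasureTheory ProbabilityTheory Filter Asymptotics

noncomputable section

/-- The function `f` of the natural number `n` is `Õ(g)`: it is `O(g)` up to a power of `log n`. -/
def IsSoftO (f g : ℕ → ℝ) : Prop :=
  ∃ k : ℕ, f =O[atTop] fun n : ℕ => g n * Real.log (n : ℝ) ^ k

/-- The parameters of a generalized Colonel Blotto game with `n` battlefields and budgets
`XA ≤ XB`: a tie-breaking parameter `α` and the values at which each of the two players
assesses each battlefield. -/
structure GCBGame (n : ℕ) (XA XB : ℝ) where
  three_le : 3 ≤ n
  XA_pos : 0 < XA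
  XA_le_XB : XA ≤ XB
  α : ℝ
  α_mem : α ∈ Set.Icc (0 : ℝ) 1
  wA : Fin n → ℝ
  wB : Fin n → ℝ
  wA_pos : ∀ i, 0 < wA i
  wB_pos : ∀ i, 0 < wB i

/-- The pure strategies of a player with budget `X`. -/
def pureStrategies (n : ℕ) (X : ℝ) : Set (Fin n → ℝ) :=
  {x | (∀ i, 0 ≤ x i) ∧ ∑ i, x i ≤ X}

/-- A mixed strategy of a player with budget `X`: a joint distribution on the allocations to all
battlefields, carried by the set of pure strategies. -/
structure IsMixedStrategy {n : ℕ} (X : ℝ) (s : Measure (Fin n → ℝ)) : Prop where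
  isProbabilityMeasure : IsProbabilityMeasure s
  ae_mem : ∀ᵐ x ∂s, x ∈ pureStrategies n X

/-- The probability distribution on `ℝ` with mass `q` at `0` that distributes the remaining mass
`1 - q` uniformly on `[0, b]`; its distribution function is `x ↦ q + (1 - q) * x / b` on
`[0, b]`. -/
def uniformType (q b : ℝ) : Measure ℝ :=
  ENNReal.ofReal q • Measure.dirac 0 + ENNReal.ofReal (1 - q) • volume[|Set.Icc 0 b]

open scoped Classical in
/-- Rescale the vector `a` so that its coordinates sum to `X`; the result is the zero vector if
the coordinates of `a` sum to `0`. -/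
def rescale {n : ℕ} (X : ℝ) (a : Fin n → ℝ) : Fin n → ℝ :=
  fun i => if ∑ j, a j = 0 then 0 else a i / (∑ j, a j) * X

namespace GCBGame

variable {n : ℕ} {XA XB : ℝ}

/-- The constant-sum games. -/
def IsConstantSum (G : GCBGame n XA XB) : Prop := ∀ i, G.wA i = G.wB i

/-- All battlefield values of both players lie between `wlo` and `whi`. -/
def ValuesBetween (G : GCBGame n XA XB) (wlo whi : ℝ) : Prop :=
  ∀ i, (wlo ≤ G.wA i ∧ G.wA i ≤ whi) ∧ (wlo ≤ G.wB i ∧ G.wB i ≤ whi)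

open scoped Classical in
/-- The Blotto function of Player A. -/
def betaA (G : GCBGame n XA XB) (x y : ℝ) : ℝ :=
  if y < x then 1 else if x = y then G.α else 0

open scoped Classical in
/-- The Blotto function of Player B. -/
def betaB (G : GCBGame n XA XB) (x y : ℝ) : ℝ :=
  if x < y then 1 else if x = y then 1 - G.α else 0

/-- The payoff of Player A when the players play the pure strategies `x` and `y`. -/
def purePayoffA (G : GCBGame n XA XB) (x y : Fin n → ℝ) : ℝ :=
  ∑ i, G.wA i * G.betaA (x i) (y i)

/-- The payoff of Player B when the players play the pure strategies `x` and `y`. -/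
def purePayoffB (G : GCBGame n XA XB) (x y : Fin n → ℝ) : ℝ :=
  ∑ i, G.wB i * G.betaB (x i) (y i)

/-- The expected payoff of Player A when the players independently play `s` and `t`. -/
def payoffA (G : GCBGame n XA XB) (s t : Measure (Fin n → ℝ)) : ℝ :=
  ∫ p, G.purePayoffA p.1 p.2 ∂(s.prod t)

/-- The expected payoff of Player B when the players independently play `s` and `t`. -/
def payoffB (G : GCBGame n XA XB) (s t : Measure (Fin n → ℝ)) : ℝ :=
  ∫ p, G.purePayoffB p.1 p.2 ∂(s.prod t)

/-- The profile `(s, t)` of mixed strategies is an `ε`-equilibrium: no player gains more than `ε`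
by deviating unilaterally to another mixed strategy. -/
structure IsApproxEquilibrium (G : GCBGame n XA XB) (ε : ℝ) (s t : Measure (Fin n → ℝ)) :
    Prop where
  mixedA : IsMixedStrategy XA s
  mixedB : IsMixedStrategy XB t
  deviationA : ∀ s', IsMixedStrategy XA s' → G.payoffA s' t ≤ G.payoffA s t + ε
  deviationB : ∀ t', IsMixedStrategy XB t' → G.payoffB s t' ≤ G.payoffB s t + ε

/-- The total value of the battlefields for Player A. -/
def WA (G : GCBGame n XA XB) : ℝ := ∑ i, G.wA i

/-- The total value of the battlefields for Player B. -/
def WB (G : GCBGame n XA XB) : ℝ := ∑ i, G.wB i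

/-- The larger of the two total values. -/
def W (G : GCBGame n XA XB) : ℝ := max G.WA G.WB

/-- The normalized battlefield values of Player A. -/
def vA (G : GCBGame n XA XB) (i : Fin n) : ℝ := G.wA i / G.WA

/-- The normalized battlefield values of Player B. -/
def vB (G : GCBGame n XA XB) (i : Fin n) : ℝ := G.wB i / G.WB

open scoped Classical in
/-- The set of battlefields `i` with `vA i / vB i > γ`. -/
def OmegaA (G : GCBGame n XA XB) (γ : ℝ) : Finset (Fin n) :=
  {i | γ < G.vA i / G.vB i}

open scoped Classical in
/-- The set of positive solutions `γ` of the equation that determines the strategies. -/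
def gammaSolutions (G : GCBGame n XA XB) : Set ℝ :=
  {γ | 0 < γ ∧
    XB * γ / XA =
      (γ ^ 2 * ∑ i ∈ G.OmegaA γ, G.vB i ^ 2 / G.vA i + ∑ i ∈ (G.OmegaA γ)ᶜ, G.vA i) /
      (∑ i ∈ G.OmegaA γ, G.vB i + 1 / γ ^ 2 * ∑ i ∈ (G.OmegaA γ)ᶜ, G.vA i ^ 2 / G.vB i)}

open scoped Classical in
/-- The constant `λ_A` associated with `γ`. -/
def lambdaA (G : GCBGame n XA XB) (γ : ℝ) : ℝ :=
  γ ^ 2 / (2 * XB) * ∑ i ∈ G.OmegaA γ, G.vB i ^ 2 / G.vA i +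
    1 / (2 * XB) * ∑ i ∈ (G.OmegaA γ)ᶜ, G.vA i

open scoped Classical in
/-- The constant `λ_B` associated with `γ`. -/
def lambdaB (G : GCBGame n XA XB) (γ : ℝ) : ℝ :=
  1 / (2 * XA) * ∑ i ∈ G.OmegaA γ, G.vB i +
    1 / (2 * γ ^ 2 * XA) * ∑ i ∈ (G.OmegaA γ)ᶜ, G.vA i ^ 2 / G.vB i

open scoped Classical in
/-- The uniform-type distribution from which Player A draws a number for battlefield `i`:
uniform on `[0, vB i / λ_B]` if `i ∈ Ω_A(γ)`; otherwise it has an atom at `0` and is uniform on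
`[0, vA i / λ_A]`. -/
def distA (G : GCBGame n XA XB) (γ : ℝ) (i : Fin n) : Measure ℝ :=
  if i ∈ G.OmegaA γ then
    uniformType 0 (G.vB i / G.lambdaB γ)
  else
    uniformType
      ((G.vB i / G.lambdaB γ - G.vA i / G.lambdaA γ) / (G.vB i / G.lambdaB γ))
      (G.vA i / G.lambdaA γ)

open scoped Classical in
/-- The uniform-type distribution from which Player B draws a number for battlefield `i`:
uniform on `[0, vA i / λ_A]` if `i ∉ Ω_A(γ)`; otherwise it has an atom at `0` and is uniform on
`[0, vB i / λ_B]`. -/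
def distB (G : GCBGame n XA XB) (γ : ℝ) (i : Fin n) : Measure ℝ :=
  if i ∈ G.OmegaA γ then
    uniformType
      ((G.vA i / G.lambdaA γ - G.vB i / G.lambdaB γ) / (G.vA i / G.lambdaA γ))
      (G.vB i / G.lambdaB γ)
  else
    uniformType 0 (G.vA i / G.lambdaA γ)

/-- The independently uniform strategy of Player A: draw the coordinates independently from
`distA` and rescale them to the budget. -/
def IUA (G : GCBGame n XA XB) (γ : ℝ) : Measure (Fin n → ℝ) :=
  (Measure.pi (G.distA γ)).map (rescale XA)

/-- The independently uniform strategy of Player B: draw the coordinates independently from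
`distB` and rescale them to the budget. -/
def IUB (G : GCBGame n XA XB) (γ : ℝ) : Measure (Fin n → ℝ) :=
  (Measure.pi (G.distB γ)).map (rescale XB)

end GCBGame

end

/-! ### Uniform-type distributions -/

/-! Equal values make `OmegaA γ` either everything or empty, and the equation becomes `(XB / XA) * γ
= γ ^ 2` in both cases. At `γ = XB / XA` both players draw on `[0, 2 * XB * vA i]`, A with an atom
of mass `1 - XA / XB` at `0` and B with none.

Only upper bounds on deviation payoffs are needed. A rescaled coordinate is at most `x` exactly when
`z i * (X - x) ≤ x * S`, where `S` is the sum of the other draws (for a nonzero total). As `S` is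
independent of `z i` and the distribution function of `z i` has a bound linear in its argument, only
the mean of `S` enters, and it is at most `X`: no concentration inequality is used
(`map_rescale_real_le`). The interval lengths are proportional to the values, so summing over
battlefields leaves a bound in terms of the deviator's budget alone (`sum_wA_mul_map_rescale_le`).

The bounds for the two players add up to at most `(1 + e) * W`. Since the payoffs at the profile add
up to `W`, each is within `e * W` of its own bound. Here `e` has the order of the largest
battlefield share, so the error is even `O(1 / n)`. -/

/-- Not truncating `t / b` at `1` keeps the bound linear for `t ≥ 0`, so that it can be averaged
over a random `t` knowing only its mean. -/
theorem uniformType_apply_Iic_le {q b : ℝ} (hb : 0 < b) (t : ℝ) :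
    uniformType q b (Set.Iic t) ≤
      ENNReal.ofReal q + ENNReal.ofReal (1 - q) * ENNReal.ofReal (t / b) := by
  simp only [uniformType, Measure.add_apply, Measure.smul_apply, smul_eq_mul]
  gcongr
  · exact mul_le_of_le_one_right' prob_le_one
  · rw [cond_apply measurableSet_Icc, Real.volume_Icc, sub_zero, ENNReal.ofReal_div_of_pos hb,
      ENNReal.div_eq_inv_mul]
    gcongr
    calc volume (Set.Icc 0 b ∩ Set.Iic t) ≤ volume (Set.Icc 0 t) :=
          measure_mono fun u hu => ⟨hu.1.1, hu.2⟩
      _ = ENNReal.ofReal t := by rw [Real.volume_Icc, sub_zero]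

theorem isProbabilityMeasure_uniformType {q b : ℝ} (hq : 0 ≤ q) (hq1 : q ≤ 1) (hb : 0 < b) :
    IsProbabilityMeasure (uniformType q b) := by
  have : IsProbabilityMeasure (volume[|Set.Icc 0 b]) :=
    cond_isProbabilityMeasure_of_finite (by simp [hb]) (by simp)
  constructor
  simp only [uniformType, Measure.add_apply, Measure.smul_apply, smul_eq_mul, measure_univ, mul_one]
  rw [← ENNReal.ofReal_add hq (by linarith)]
  simp

theorem ae_nonneg_uniformType (q b : ℝ) : ∀ᵐ u ∂uniformType q b, 0 ≤ u := by
  rw [uniformType, ae_add_measure_iff]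
  constructor
  · refine Measure.ae_smul_measure ?_ _
    simp [ae_dirac_eq]
  · refine Measure.ae_smul_measure ?_ _
    filter_upwards [ae_cond_mem measurableSet_Icc] with u hu using hu.1

theorem lintegral_ofReal_uniformType {q b : ℝ} (hq1 : q ≤ 1) (hb : 0 < b) :
    ∫⁻ u, ENNReal.ofReal u ∂uniformType q b = ENNReal.ofReal ((1 - q) * (b / 2)) := by
  have hI : ∫⁻ u in Set.Icc 0 b, ENNReal.ofReal u = ENNReal.ofReal (b ^ 2 / 2) := by
    rw [← ofReal_integral_eq_lintegral_ofReal, integral_Icc_eq_integral_Ioc,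
      ← intervalIntegral.integral_of_le hb.le, integral_id]
    · simp
    · exact continuous_id.integrableOn_Icc
    · filter_upwards [ae_restrict_mem measurableSet_Icc] with u hu using hu.1
  have hC : ∫⁻ u, ENNReal.ofReal u ∂volume[|Set.Icc 0 b] = ENNReal.ofReal (b / 2) := by
    rw [ProbabilityTheory.cond, lintegral_smul_measure, hI, Real.volume_Icc, sub_zero,
      ← ENNReal.ofReal_inv_of_pos hb, smul_eq_mul, ← ENNReal.ofReal_mul (by positivity)]
    congr 1
    field_simp
  rw [uniformType, lintegral_add_measure, lintegral_smul_measure, lintegral_smul_measure, hC,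
    lintegral_dirac, smul_eq_mul, smul_eq_mul, ENNReal.ofReal_zero, mul_zero, zero_add,
    ← ENNReal.ofReal_mul (by linarith)]

/-! ### Rescaled independent draws -/

section Rescale

variable {n : ℕ}

theorem measurable_rescale (X : ℝ) : Measurable (rescale (n := n) X) := by
  refine measurable_pi_lambda _ fun i => ?_
  unfold rescale
  refine Measurable.ite ?_ measurable_const (by fun_prop)
  exact measurableSet_eq_fun (by fun_prop) measurable_const

theorem rescale_mem_pureStrategies {X : ℝ} (hX : 0 ≤ X) {z : Fin n → ℝ} (hz : ∀ i, 0 ≤ z i) :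
    rescale X z ∈ pureStrategies n X := by
  by_cases h : ∑ j, z j = 0
  · exact ⟨fun i => by simp [rescale, h], by simp [rescale, h, hX]⟩
  · have hs : 0 ≤ ∑ j, z j := Finset.sum_nonneg fun j _ => hz j
    refine ⟨fun i => ?_, ?_⟩
    · simp only [rescale, h, if_false]
      have := hz i
      positivity
    · simp only [rescale, h, if_false]
      rw [← Finset.sum_mul, ← Finset.sum_div, div_self h, one_mul]

/-- Clearing the denominator and moving `z i` to one side separates it from the other coordinates,
which are independent of it. -/
theorem mul_sub_le_of_rescale_le {X x : ℝ} (hX : 0 ≤ X) {z : Fin n → ℝ} (hz : ∀ i, 0 ≤ z i)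
    {i : Fin n} (h : rescale X z i ≤ x) :
    z i * (X - x) ≤ x * ∑ j ∈ Finset.univ.erase i, z j := by
  have hx : 0 ≤ x := ((rescale_mem_pureStrategies hX hz).1 i).trans h
  have hsum := Finset.add_sum_erase Finset.univ z (Finset.mem_univ i)
  have hr : 0 ≤ ∑ j ∈ Finset.univ.erase i, z j := Finset.sum_nonneg fun j _ => hz j
  by_cases h0 : ∑ j, z j = 0
  · have : z i = 0 := le_antisymm (by linarith) (hz i)
    rw [this, zero_mul]
    positivity
  · have hpos : 0 < ∑ j, z j := lt_of_le_of_ne (Finset.sum_nonneg fun j _ => hz j) (Ne.symm h0)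
    simp only [rescale, h0, if_false] at h
    rw [div_mul_eq_mul_div, div_le_iff₀ hpos] at h
    linarith [mul_add x (z i) (∑ j ∈ Finset.univ.erase i, z j), congrArg (x * ·) hsum]

variable {q X : ℝ} {b : Fin n → ℝ}

theorem ae_nonneg_pi_uniformType (hq : 0 ≤ q) (hq1 : q ≤ 1) (hb : ∀ i, 0 < b i) :
    ∀ᵐ z ∂Measure.pi (fun i => uniformType q (b i)), ∀ i, 0 ≤ z i := by
  have := fun i => isProbabilityMeasure_uniformType hq hq1 (hb i)
  rw [ae_all_iff]
  exact fun i => (Measure.quasiMeasurePreserving_eval (fun i => uniformType q (b i)) i).ae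
    (ae_nonneg_uniformType q (b i))

theorem isMixedStrategy_map_rescale (hq : 0 ≤ q) (hq1 : q ≤ 1) (hb : ∀ i, 0 < b i) (hX : 0 ≤ X) :
    IsMixedStrategy X ((Measure.pi fun i => uniformType q (b i)).map (rescale X)) := by
  have := fun i => isProbabilityMeasure_uniformType hq hq1 (hb i)
  refine ⟨Measure.isProbabilityMeasure_map (measurable_rescale X).aemeasurable, ?_⟩
  have hm : MeasurableSet (pureStrategies n X) := by
    have : pureStrategies n X = (⋂ i, {x | 0 ≤ x i}) ∩ {x | ∑ i, x i ≤ X} := by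
      ext x; simp [pureStrategies]
    rw [this]
    refine (MeasurableSet.iInter fun i => ?_).inter ?_
    · exact measurableSet_le measurable_const (measurable_pi_apply i)
    · exact measurableSet_le (by fun_prop) measurable_const
  rw [ae_map_iff (p := (· ∈ pureStrategies n X)) (measurable_rescale X).aemeasurable hm]
  filter_upwards [ae_nonneg_pi_uniformType hq hq1 hb] with z hz
  exact rescale_mem_pureStrategies hX hz

/-- Hypothesis `hX` says that the draws have expected total `X`; dropping a nonnegative coordinate
can only lower it. -/
theorem lintegral_ofReal_sum_erase_le (hq : 0 ≤ q) (hq1 : q ≤ 1) (hb : ∀ i, 0 < b i)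
    (hX : (1 - q) * ∑ i, b i / 2 = X) (i : Fin n) :
    ∫⁻ z, ENNReal.ofReal (∑ j ∈ Finset.univ.erase i, z j)
      ∂Measure.pi (fun i => uniformType q (b i)) ≤ ENNReal.ofReal X := by
  have := fun i => isProbabilityMeasure_uniformType hq hq1 (hb i)
  have hj : ∀ j, ∫⁻ z, ENNReal.ofReal (z j) ∂Measure.pi (fun i => uniformType q (b i)) =
      ENNReal.ofReal ((1 - q) * (b j / 2)) := fun j => by
    rw [← lintegral_ofReal_uniformType hq1 (hb j)]
    exact (measurePreserving_eval (fun i => uniformType q (b i)) j).lintegral_comp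
      ENNReal.measurable_ofReal
  have hnn : ∀ j, 0 ≤ (1 - q) * (b j / 2) := fun j =>
    mul_nonneg (by linarith) (by linarith [hb j])
  calc _ = ∫⁻ z, ∑ j ∈ Finset.univ.erase i, ENNReal.ofReal (z j)
        ∂Measure.pi (fun i => uniformType q (b i)) := by
        refine lintegral_congr_ae ?_
        filter_upwards [ae_nonneg_pi_uniformType hq hq1 hb] with z hz
        exact ENNReal.ofReal_sum_of_nonneg fun j _ => hz j
    _ = ∑ j ∈ Finset.univ.erase i, ENNReal.ofReal ((1 - q) * (b j / 2)) := by
        rw [lintegral_finsetSum _ fun j _ => by fun_prop]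
        exact Finset.sum_congr rfl fun j _ => hj j
    _ = ENNReal.ofReal (∑ j ∈ Finset.univ.erase i, (1 - q) * (b j / 2)) :=
        (ENNReal.ofReal_sum_of_nonneg fun j _ => hnn j).symm
    _ ≤ ENNReal.ofReal X := by
        refine ENNReal.ofReal_le_ofReal ?_
        rw [← hX, Finset.mul_sum]
        exact Finset.sum_le_sum_of_subset_of_nonneg (Finset.erase_subset _ _) fun j _ _ => hnn j

theorem pi_uniformType_mul_le_mul_sum_erase (hq : 0 ≤ q) (hq1 : q ≤ 1) (hb : ∀ i, 0 < b i)
    (hX : (1 - q) * ∑ i, b i / 2 = X) (i : Fin n) {x : ℝ} (hx : 0 ≤ x) (hxX : x < X) :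
    Measure.pi (fun i => uniformType q (b i))
        {z | z i * (X - x) ≤ x * ∑ j ∈ Finset.univ.erase i, z j} ≤
      ENNReal.ofReal (q + (1 - q) * (x / ((X - x) * b i) * X)) := by
  have := fun i => isProbabilityMeasure_uniformType hq hq1 (hb i)
  set π := Measure.pi (fun i => uniformType q (b i)) with hπ
  have hXx : 0 < X - x := by linarith
  have hc : 0 ≤ x / ((X - x) * b i) := div_nonneg hx (mul_pos hXx (hb i)).le
  let S : (Fin n → ℝ) → ℝ := fun z => ∑ j ∈ Finset.univ.erase i, z j
  have hS : Measurable S := by fun_prop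
  have hindep : S ⟂ᵢ[π] fun z => z i := by
    have h := (iIndepFun_pi (μ := fun i => uniformType q (b i)) (X := fun _ u => u)
      fun i => aemeasurable_id).indepFun_finsetSum_of_notMem
        (fun i => measurable_pi_apply i) (Finset.notMem_erase i Finset.univ)
    convert h using 1
    ext z
    simp [S]
  have hlaw := (indepFun_iff_map_prod_eq_prod_map_map hS.aemeasurable
    (measurable_pi_apply i).aemeasurable).1 hindep
  have hpi : π.map (fun z => z i) = uniformType q (b i) :=
    (measurePreserving_eval (fun i => uniformType q (b i)) i).map_eq
  rw [hpi] at hlaw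
  have hD : MeasurableSet {p : ℝ × ℝ | p.2 * (X - x) ≤ x * p.1} :=
    measurableSet_le (by fun_prop) (by fun_prop)
  calc π {z | z i * (X - x) ≤ x * ∑ j ∈ Finset.univ.erase i, z j}
      = π.map (fun z => (S z, z i)) {p : ℝ × ℝ | p.2 * (X - x) ≤ x * p.1} :=
        (Measure.map_apply (hS.prodMk (measurable_pi_apply i)) hD).symm
    -- Independence turns the joint law into a product, so one can condition on the sum `s` of the
    -- other draws.
    _ = ∫⁻ s, uniformType q (b i) {u | u * (X - x) ≤ x * s} ∂π.map S := by
        rw [hlaw, Measure.prod_apply hD]; rfl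
    _ ≤ ∫⁻ s, (ENNReal.ofReal q + ENNReal.ofReal (1 - q) *
          (ENNReal.ofReal (x / ((X - x) * b i)) * ENNReal.ofReal s)) ∂π.map S := by
        refine lintegral_mono fun s => ?_
        have : {u | u * (X - x) ≤ x * s} = Set.Iic (x * s / (X - x)) := by
          ext u; simp [le_div_iff₀ hXx]
        rw [this, ← ENNReal.ofReal_mul hc]
        convert uniformType_apply_Iic_le (hb i) (x * s / (X - x)) using 4
        rw [div_div]
        ring
    _ = ENNReal.ofReal q + ENNReal.ofReal (1 - q) *
          (ENNReal.ofReal (x / ((X - x) * b i)) * ∫⁻ z, ENNReal.ofReal (S z) ∂π) := by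
        have := Measure.isProbabilityMeasure_map (μ := π) hS.aemeasurable
        rw [lintegral_add_left measurable_const, lintegral_const, measure_univ, mul_one,
          lintegral_const_mul _ (by fun_prop), lintegral_const_mul _ (by fun_prop),
          lintegral_map (by fun_prop) hS]
    _ ≤ ENNReal.ofReal q + ENNReal.ofReal (1 - q) *
          (ENNReal.ofReal (x / ((X - x) * b i)) * ENNReal.ofReal X) := by
        gcongr
        exact lintegral_ofReal_sum_erase_le hq hq1 hb hX i
    _ = _ := by
        rw [← ENNReal.ofReal_mul hc, ← ENNReal.ofReal_mul (by linarith),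
          ← ENNReal.ofReal_add hq]
        exact mul_nonneg (by linarith) (mul_nonneg hc (by linarith))

/-- The distribution function of a coordinate of the rescaled vector is, up to the relative error
`e`, bounded by the distribution function of the coordinate before rescaling. -/
theorem map_rescale_real_le (hq : 0 ≤ q) (hq1 : q ≤ 1) (hb : ∀ i, 0 < b i)
    (hX : (1 - q) * ∑ i, b i / 2 = X) {e : ℝ} (he1 : e ≤ 1) {i : Fin n} (hbe : 2 * b i ≤ e * X)
    {x : ℝ} (hx : 0 ≤ x) :
    ((Measure.pi fun i => uniformType q (b i)).map (rescale X)).real {y | y i ≤ x} ≤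
      q + (1 - q) * (x / b i * (1 + e)) := by
  have := fun i => isProbabilityMeasure_uniformType hq hq1 (hb i)
  have hbi := hb i
  have := Measure.isProbabilityMeasure_map (μ := Measure.pi fun i => uniformType q (b i))
    (measurable_rescale X).aemeasurable
  have hX0 : 0 ≤ X := by
    rw [← hX]
    exact mul_nonneg (by linarith) (Finset.sum_nonneg fun j _ => by linarith [hb j])
  have he : 0 < e := by
    by_contra! h
    linarith [mul_nonpos_of_nonpos_of_nonneg h hX0]
  -- For `x ≥ b i` the right-hand side is already at least `1`.
  rcases le_or_gt (b i) x with hle | hlt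
  · refine measureReal_le_one.trans ?_
    have : 1 ≤ x / b i * (1 + e) :=
      one_le_mul_of_one_le_of_one_le ((one_le_div hbi).2 hle) (by linarith)
    nlinarith
  · have h2 : 2 * b i ≤ X := hbe.trans (by nlinarith)
    have hxX : 0 < X - x := by linarith
    -- Equivalent to `(1 + e) * x ≤ e * X`, which follows from `1 + e ≤ 2` and `2 * x < 2 * b i ≤ e
    -- * X`.
    have hfrac : X / (X - x) ≤ 1 + e := by
      rw [div_le_iff₀ hxX]
      nlinarith
    have hnn : 0 ≤ x / b i := by positivity
    have hkey : q + (1 - q) * (x / ((X - x) * b i) * X) ≤ q + (1 - q) * (x / b i * (1 + e)) := by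
      have : x / ((X - x) * b i) * X = x / b i * (X / (X - x)) := by
        field_simp
      rw [this]
      gcongr
    refine le_trans ?_ hkey
    refine ENNReal.toReal_le_of_le_ofReal ?_ ?_
    · have := sub_nonneg.2 hq1
      positivity
    · rw [Measure.map_apply (measurable_rescale X)
        (measurableSet_le (measurable_pi_apply i) measurable_const)]
      refine (measure_mono_ae ?_).trans
        (pi_uniformType_mul_le_mul_sum_erase hq hq1 hb hX i hx (by linarith))
      filter_upwards [ae_nonneg_pi_uniformType hq hq1 hb] with z hz h
      exact mul_sub_le_of_rescale_le hX0 hz h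

end Rescale

namespace GCBGame

variable {n : ℕ} {XA XB : ℝ}

/-! ### Payoffs -/

theorem betaA_nonneg (G : GCBGame n XA XB) (x y : ℝ) : 0 ≤ G.betaA x y := by
  unfold betaA
  split_ifs
  exacts [zero_le_one, G.α_mem.1, le_rfl]

theorem betaA_add_betaB (G : GCBGame n XA XB) (x y : ℝ) : G.betaA x y + G.betaB x y = 1 := by
  unfold betaA betaB
  rcases lt_trichotomy x y with h | h | h
  · simp [h, h.not_gt, h.ne]
  · simp [h]
  · simp [h, h.not_gt, h.ne']

theorem betaB_nonneg (G : GCBGame n XA XB) (x y : ℝ) : 0 ≤ G.betaB x y := by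
  unfold betaB
  split_ifs
  exacts [zero_le_one, sub_nonneg.2 G.α_mem.2, le_rfl]

theorem betaA_le_one (G : GCBGame n XA XB) (x y : ℝ) : G.betaA x y ≤ 1 := by
  linarith [G.betaA_add_betaB x y, G.betaB_nonneg x y]

theorem betaB_le_one (G : GCBGame n XA XB) (x y : ℝ) : G.betaB x y ≤ 1 := by
  linarith [G.betaA_add_betaB x y, G.betaA_nonneg x y]

theorem betaA_eq_zero (G : GCBGame n XA XB) {x y : ℝ} (h : x < y) : G.betaA x y = 0 := by
  simp [betaA, h.not_gt, h.ne]

theorem betaB_eq_zero (G : GCBGame n XA XB) {x y : ℝ} (h : y < x) : G.betaB x y = 0 := by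
  simp [betaB, h.not_gt, h.ne']

theorem measurable_betaA (G : GCBGame n XA XB) {Ω : Type*} [MeasurableSpace Ω] {f g : Ω → ℝ}
    (hf : Measurable f) (hg : Measurable g) : Measurable fun ω => G.betaA (f ω) (g ω) := by
  unfold betaA
  exact Measurable.ite (measurableSet_lt hg hf) measurable_const
    (Measurable.ite (measurableSet_eq_fun hf hg) measurable_const
      measurable_const)

theorem measurable_betaB (G : GCBGame n XA XB) {Ω : Type*} [MeasurableSpace Ω] {f g : Ω → ℝ}
    (hf : Measurable f) (hg : Measurable g) : Measurable fun ω => G.betaB (f ω) (g ω) := by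
  unfold betaB
  exact Measurable.ite (measurableSet_lt hf hg) measurable_const
    (Measurable.ite (measurableSet_eq_fun hf hg) measurable_const
      measurable_const)

theorem measurable_purePayoffA (G : GCBGame n XA XB) :
    Measurable fun p : (Fin n → ℝ) × (Fin n → ℝ) => G.purePayoffA p.1 p.2 := by
  unfold purePayoffA
  refine Finset.measurable_fun_sum _ fun i _ => measurable_const.mul (G.measurable_betaA ?_ ?_)
  all_goals fun_prop

theorem measurable_purePayoffB (G : GCBGame n XA XB) :
    Measurable fun p : (Fin n → ℝ) × (Fin n → ℝ) => G.purePayoffB p.1 p.2 := by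
  unfold purePayoffB
  refine Finset.measurable_fun_sum _ fun i _ => measurable_const.mul (G.measurable_betaB ?_ ?_)
  all_goals fun_prop

theorem purePayoffA_nonneg (G : GCBGame n XA XB) (x y : Fin n → ℝ) : 0 ≤ G.purePayoffA x y :=
  Finset.sum_nonneg fun i _ => mul_nonneg (G.wA_pos i).le (G.betaA_nonneg _ _)

theorem purePayoffB_nonneg (G : GCBGame n XA XB) (x y : Fin n → ℝ) : 0 ≤ G.purePayoffB x y :=
  Finset.sum_nonneg fun i _ => mul_nonneg (G.wB_pos i).le (G.betaB_nonneg _ _)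

theorem purePayoffA_le (G : GCBGame n XA XB) (x y : Fin n → ℝ) : G.purePayoffA x y ≤ G.WA :=
  Finset.sum_le_sum fun i _ => mul_le_of_le_one_right (G.wA_pos i).le (G.betaA_le_one _ _)

theorem purePayoffB_le (G : GCBGame n XA XB) (x y : Fin n → ℝ) : G.purePayoffB x y ≤ G.WB :=
  Finset.sum_le_sum fun i _ => mul_le_of_le_one_right (G.wB_pos i).le (G.betaB_le_one _ _)

theorem purePayoffA_add_purePayoffB (G : GCBGame n XA XB) (hG : G.IsConstantSum)
    (x y : Fin n → ℝ) : G.purePayoffA x y + G.purePayoffB x y = G.WA := by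
  rw [purePayoffA, purePayoffB, WA, ← Finset.sum_add_distrib]
  refine Finset.sum_congr rfl fun i _ => ?_
  rw [← hG i, ← mul_add, betaA_add_betaB, mul_one]

theorem integrable_purePayoffA (G : GCBGame n XA XB)
    (m : Measure ((Fin n → ℝ) × (Fin n → ℝ))) [IsFiniteMeasure m] :
    Integrable (fun p => G.purePayoffA p.1 p.2) m :=
  Integrable.of_bound G.measurable_purePayoffA.aestronglyMeasurable G.WA
    (Eventually.of_forall fun p => by
      rw [Real.norm_of_nonneg (G.purePayoffA_nonneg _ _)]
      exact G.purePayoffA_le _ _)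

theorem integrable_purePayoffB (G : GCBGame n XA XB)
    (m : Measure ((Fin n → ℝ) × (Fin n → ℝ))) [IsFiniteMeasure m] :
    Integrable (fun p => G.purePayoffB p.1 p.2) m :=
  Integrable.of_bound G.measurable_purePayoffB.aestronglyMeasurable G.WB
    (Eventually.of_forall fun p => by
      rw [Real.norm_of_nonneg (G.purePayoffB_nonneg _ _)]
      exact G.purePayoffB_le _ _)

theorem payoffA_add_payoffB (G : GCBGame n XA XB) (hG : G.IsConstantSum)
    (s t : Measure (Fin n → ℝ)) [IsProbabilityMeasure s] [IsProbabilityMeasure t] :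
    G.payoffA s t + G.payoffB s t = G.WA := by
  rw [payoffA, payoffB, ← integral_add (G.integrable_purePayoffA _) (G.integrable_purePayoffB _)]
  simp [G.purePayoffA_add_purePayoffB hG]

end GCBGame

/-! ### Deviation payoffs bounded through marginal distribution functions -/

/-- Ties are counted as full wins for the deviator, so `α` disappears from the estimates and one
lemma serves both players. -/
theorem sum_mul_integral_le {n : ℕ} {w : Fin n → ℝ} (hw : ∀ i, 0 ≤ w i)
    {m : Measure (Fin n → ℝ)} [IsProbabilityMeasure m] {x : Fin n → ℝ}
    {f : Fin n → (Fin n → ℝ) → ℝ} (hf : ∀ i, Measurable (f i)) (hf0 : ∀ i y, 0 ≤ f i y)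
    (hf1 : ∀ i y, f i y ≤ 1) (hfx : ∀ i y, x i < y i → f i y = 0) :
    ∫ y, ∑ i, w i * f i y ∂m ≤ ∑ i, w i * m.real {y | y i ≤ x i} := by
  have hint : ∀ i, Integrable (f i) m := fun i =>
    Integrable.of_bound (hf i).aestronglyMeasurable 1 (Eventually.of_forall fun y => by
      rw [Real.norm_of_nonneg (hf0 i y)]
      exact hf1 i y)
  rw [integral_finsetSum _ fun i _ => (hint i).const_mul _]
  refine Finset.sum_le_sum fun i _ => ?_
  rw [integral_const_mul]
  refine mul_le_mul_of_nonneg_left ?_ (hw i)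
  have hms : MeasurableSet {y : Fin n → ℝ | y i ≤ x i} :=
    measurableSet_le (measurable_pi_apply i) measurable_const
  rw [← integral_indicator_one hms]
  refine integral_mono (hint i) ((integrable_const 1).indicator hms) fun y => ?_
  by_cases h : y i ≤ x i
  · simpa [h] using hf1 i y
  · simp [h, hfx i y (not_le.1 h)]

namespace GCBGame

variable {n : ℕ} {XA XB : ℝ}

/-- By Fubini a mixed deviation is an average of pure ones, so a uniform bound over pure strategies
suffices. -/
theorem payoffA_le_of_forall (G : GCBGame n XA XB) {s t : Measure (Fin n → ℝ)}
    (hs : IsMixedStrategy XA s) [IsProbabilityMeasure t] {K : ℝ}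
    (hK : ∀ x ∈ pureStrategies n XA, ∑ i, G.wA i * t.real {y | y i ≤ x i} ≤ K) :
    G.payoffA s t ≤ K := by
  have := hs.isProbabilityMeasure
  have hint := G.integrable_purePayoffA (s.prod t)
  rw [payoffA, integral_prod _ hint, show K = ∫ _, K ∂s by simp]
  refine integral_mono_ae hint.integral_prod_left (integrable_const K) ?_
  filter_upwards [hs.ae_mem] with x hx
  refine le_trans ?_ (hK x hx)
  exact sum_mul_integral_le (fun i => (G.wA_pos i).le)
    (fun i => G.measurable_betaA measurable_const (measurable_pi_apply i))
    (fun i y => G.betaA_nonneg _ _) (fun i y => G.betaA_le_one _ _)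
    fun i y h => G.betaA_eq_zero h

theorem payoffB_le_of_forall (G : GCBGame n XA XB) {s t : Measure (Fin n → ℝ)}
    [IsProbabilityMeasure s] (ht : IsMixedStrategy XB t) {K : ℝ}
    (hK : ∀ x ∈ pureStrategies n XB, ∑ i, G.wB i * s.real {y | y i ≤ x i} ≤ K) :
    G.payoffB s t ≤ K := by
  have := ht.isProbabilityMeasure
  have hint := G.integrable_purePayoffB (s.prod t)
  rw [payoffB, integral_prod_symm _ hint, show K = ∫ _, K ∂t by simp]
  refine integral_mono_ae hint.integral_prod_right (integrable_const K) ?_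
  filter_upwards [ht.ae_mem] with x hx
  refine le_trans ?_ (hK x hx)
  exact sum_mul_integral_le (fun i => (G.wB_pos i).le)
    (fun i => G.measurable_betaB (measurable_pi_apply i) measurable_const)
    (fun i y => G.betaB_nonneg _ _) (fun i y => G.betaB_le_one _ _)
    fun i y h => G.betaB_eq_zero h

/-! ### Constant-sum games -/

theorem WA_pos (G : GCBGame n XA XB) : 0 < G.WA :=
  Finset.sum_pos (fun i _ => G.wA_pos i) ⟨⟨0, by linarith [G.three_le]⟩, Finset.mem_univ _⟩

theorem vA_pos (G : GCBGame n XA XB) (i : Fin n) : 0 < G.vA i := div_pos (G.wA_pos i) G.WA_pos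

theorem sum_vA (G : GCBGame n XA XB) : ∑ i, G.vA i = 1 := by
  simp only [vA, ← Finset.sum_div]
  exact div_self G.WA_pos.ne'

theorem XB_pos (G : GCBGame n XA XB) : 0 < XB := G.XA_pos.trans_le G.XA_le_XB

namespace IsConstantSum

variable {G : GCBGame n XA XB}

theorem wB_eq (hG : G.IsConstantSum) : G.wB = G.wA := (funext hG).symm

theorem WB_eq (hG : G.IsConstantSum) : G.WB = G.WA := by rw [WB, hG.wB_eq, WA]

theorem W_eq (hG : G.IsConstantSum) : G.W = G.WA := by rw [W, hG.WB_eq, max_self]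

theorem vB_eq (hG : G.IsConstantSum) : G.vB = G.vA := by
  ext i
  rw [vB, hG.wB_eq, hG.WB_eq, vA]

theorem OmegaA_eq_empty (hG : G.IsConstantSum) {γ : ℝ} (hγ : 1 ≤ γ) : G.OmegaA γ = ∅ := by
  simp [OmegaA, hG.vB_eq, div_self (G.vA_pos _).ne', hγ]

theorem OmegaA_eq_univ (hG : G.IsConstantSum) {γ : ℝ} (hγ : γ < 1) :
    G.OmegaA γ = Finset.univ := by
  simp [OmegaA, hG.vB_eq, div_self (G.vA_pos _).ne', hγ]

theorem sum_vA_sq_div_vB (hG : G.IsConstantSum) : ∑ i, G.vA i ^ 2 / G.vB i = 1 := by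
  rw [hG.vB_eq, ← G.sum_vA]
  refine Finset.sum_congr rfl fun i _ => ?_
  rw [sq, mul_div_assoc, div_self (G.vA_pos i).ne', mul_one]

/-- For `γ < 1` and for `γ ≥ 1` alike the right-hand side of the equation is `γ ^ 2`; the only
candidate `XB / XA` lies in the second range. -/
theorem gammaSolutions_eq (hG : G.IsConstantSum) : G.gammaSolutions = {XB / XA} := by
  have hA := G.XA_pos
  have hB := G.XB_pos
  have hAB := G.XA_le_XB
  have h1 : 1 ≤ XB / XA := (one_le_div hA).2 hAB
  have hv := hG.sum_vA_sq_div_vB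
  ext γ
  simp only [gammaSolutions, Set.mem_ofPred_eq, Set.mem_singleton_iff]
  rcases lt_or_ge γ 1 with hγ | hγ
  · rw [hG.OmegaA_eq_univ hγ]
    have hv' : ∑ i, G.vB i ^ 2 / G.vA i = 1 := by
      rw [← hv, hG.vB_eq]
    have hs : ∑ i, G.vB i = 1 := by rw [hG.vB_eq, G.sum_vA]
    simp only [Finset.compl_univ, Finset.sum_empty, hv', hs]
    refine ⟨fun ⟨h0, h⟩ => ?_, fun h => by linarith⟩
    have : γ = XB / XA := by
      have h' : XB / XA * γ = γ * γ := by
        rw [← mul_div_right_comm, h]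
        ring
      exact (mul_right_cancel₀ h0.ne' h').symm
    exact this
  · rw [hG.OmegaA_eq_empty hγ]
    simp only [Finset.compl_empty, Finset.sum_empty, hv, G.sum_vA]
    have h0 : 0 < γ := by linarith
    have hr : (γ ^ 2 * 0 + 1) / (0 + 1 / γ ^ 2 * 1) = γ * γ := by
      field_simp
    rw [hr, mul_div_right_comm]
    exact ⟨fun ⟨_, h⟩ => (mul_right_cancel₀ h0.ne' h).symm, fun h => ⟨h0, by rw [← h]⟩⟩

theorem lambdaA_eq (hG : G.IsConstantSum) : G.lambdaA (XB / XA) = 1 / (2 * XB) := by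
  rw [lambdaA, hG.OmegaA_eq_empty ((one_le_div G.XA_pos).2 G.XA_le_XB)]
  simp [G.sum_vA]

theorem lambdaB_eq (hG : G.IsConstantSum) : G.lambdaB (XB / XA) = XA / (2 * XB ^ 2) := by
  have hA := G.XA_pos
  have hB := G.XB_pos
  rw [lambdaB, hG.OmegaA_eq_empty ((one_le_div G.XA_pos).2 G.XA_le_XB), Finset.compl_empty,
    hG.sum_vA_sq_div_vB]
  simp only [Finset.sum_empty]
  field_simp
  ring

/-- The atom has the same mass on every battlefield, which is why the rescaling lemmas take a single
`q`. -/
theorem distA_eq (hG : G.IsConstantSum) :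
    G.distA (XB / XA) = fun i => uniformType (1 - XA / XB) (2 * XB * G.vA i) := by
  have hA := G.XA_pos
  have hB := G.XB_pos
  ext1 i
  have hv := G.vA_pos i
  rw [distA, hG.OmegaA_eq_empty ((one_le_div G.XA_pos).2 G.XA_le_XB), if_neg (by simp),
    hG.lambdaA_eq, hG.lambdaB_eq, hG.vB_eq]
  congr 1 <;> field_simp

theorem distB_eq (hG : G.IsConstantSum) :
    G.distB (XB / XA) = fun i => uniformType 0 (2 * XB * G.vA i) := by
  ext1 i
  rw [distB, hG.OmegaA_eq_empty ((one_le_div G.XA_pos).2 G.XA_le_XB), if_neg (by simp),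
    hG.lambdaA_eq]
  congr 1
  rw [div_div_eq_mul_div, div_one, mul_comm]

end IsConstantSum

/-- Against the rescaled uniform-type draws with an atom of mass `q`, a pure strategy of total
size at most `Y` wins at most the share `q + (1 - q) * Y / (2 * XB)` of the total value, up to the
relative error `e`. -/
theorem sum_wA_mul_map_rescale_le (G : GCBGame n XA XB) {q X Y e : ℝ} (hq : 0 ≤ q) (hq1 : q ≤ 1)
    (hX : (1 - q) * XB = X) (he0 : 0 ≤ e) (he1 : e ≤ 1)
    (hbe : ∀ i, 2 * (2 * XB * G.vA i) ≤ e * X) {x : Fin n → ℝ} (hx : x ∈ pureStrategies n Y) :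
    ∑ i, G.wA i * ((Measure.pi fun i => uniformType q (2 * XB * G.vA i)).map
        (rescale X)).real {y | y i ≤ x i} ≤
      G.WA * (q + (1 - q) * (Y / (2 * XB) * (1 + e))) := by
  have hB := G.XB_pos
  have hW := G.WA_pos
  have hb : ∀ i, 0 < 2 * XB * G.vA i := fun i => by
    have := G.vA_pos i
    positivity
  have hsum : (1 - q) * ∑ i, 2 * XB * G.vA i / 2 = X := by
    rw [← Finset.sum_div, ← Finset.mul_sum, G.sum_vA, ← hX]
    ring
  calc _ ≤ ∑ i, G.wA i * (q + (1 - q) * (x i / (2 * XB * G.vA i) * (1 + e))) :=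
        Finset.sum_le_sum fun i _ => mul_le_mul_of_nonneg_left
          (map_rescale_real_le hq hq1 hb hsum he1 (hbe i) (hx.1 i)) (G.wA_pos i).le
    -- The ratio `wA i / (2 * XB * vA i)` equals `WA / (2 * XB)` for every `i`, so only the total of
    -- `x` matters.
    _ = ∑ i, (G.wA i * q + (1 - q) * (1 + e) * G.WA / (2 * XB) * x i) := by
        refine Finset.sum_congr rfl fun i _ => ?_
        have := G.wA_pos i
        rw [vA]
        field_simp
    _ = G.WA * q + (1 - q) * (1 + e) * G.WA / (2 * XB) * ∑ i, x i := by
        rw [Finset.sum_add_distrib, ← Finset.sum_mul, ← Finset.mul_sum, WA]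
    _ ≤ G.WA * q + (1 - q) * (1 + e) * G.WA / (2 * XB) * Y := by
        have := sub_nonneg.2 hq1
        gcongr
        exact hx.2
    _ = _ := by
        field_simp

theorem payoffA_le (G : GCBGame n XA XB) (s t : Measure (Fin n → ℝ)) [IsProbabilityMeasure s]
    [IsProbabilityMeasure t] : G.payoffA s t ≤ G.WA := by
  rw [payoffA]
  refine (integral_mono (G.integrable_purePayoffA _) (integrable_const G.WA)
    fun p => G.purePayoffA_le _ _).trans_eq (by simp)

theorem payoffB_le (G : GCBGame n XA XB) (s t : Measure (Fin n → ℝ)) [IsProbabilityMeasure s]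
    [IsProbabilityMeasure t] : G.payoffB s t ≤ G.WB := by
  rw [payoffB]
  refine (integral_mono (G.integrable_purePayoffB _) (integrable_const G.WB)
    fun p => G.purePayoffB_le _ _).trans_eq (by simp)

theorem payoffA_nonneg (G : GCBGame n XA XB) (s t : Measure (Fin n → ℝ)) : 0 ≤ G.payoffA s t :=
  integral_nonneg fun _ => G.purePayoffA_nonneg _ _

theorem payoffB_nonneg (G : GCBGame n XA XB) (s t : Measure (Fin n → ℝ)) : 0 ≤ G.payoffB s t :=
  integral_nonneg fun _ => G.purePayoffB_nonneg _ _

/-- The independently uniform strategies form an approximate equilibrium whose error is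
proportional to the largest battlefield share. -/
theorem IsConstantSum.isApproxEquilibrium_IU {G : GCBGame n XA XB} (hG : G.IsConstantSum) {e : ℝ}
    (he0 : 0 ≤ e) (hbe : ∀ i, 4 * XB * G.vA i ≤ e * XA) :
    G.IsApproxEquilibrium (e * G.W) (G.IUA (XB / XA)) (G.IUB (XB / XA)) := by
  have hA := G.XA_pos
  have hB := G.XB_pos
  have hAB := G.XA_le_XB
  have hW := G.WA_pos
  have hr0 : 0 ≤ XA / XB := by positivity
  have hr1 : XA / XB ≤ 1 := (div_le_one hB).2 hAB
  have hb : ∀ i, 0 < 2 * XB * G.vA i := fun i => by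
    have := G.vA_pos i
    positivity
  have hs : IsMixedStrategy XA (G.IUA (XB / XA)) := by
    rw [IUA, hG.distA_eq]
    exact isMixedStrategy_map_rescale (by linarith) (by linarith) hb hA.le
  have ht : IsMixedStrategy XB (G.IUB (XB / XA)) := by
    rw [IUB, hG.distB_eq]
    exact isMixedStrategy_map_rescale le_rfl zero_le_one hb hB.le
  have := hs.isProbabilityMeasure
  have := ht.isProbabilityMeasure
  have hconst := G.payoffA_add_payoffB hG (G.IUA (XB / XA)) (G.IUB (XB / XA))
  rw [hG.W_eq]
  -- For `e ≥ 1` the claim is trivial, all payoffs lying between `0` and `WA`; the rescaling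
  -- estimate needs `e ≤ 1`.
  rcases le_or_gt 1 e with he1 | he1
  · have hle : G.WA ≤ e * G.WA := le_mul_of_one_le_left hW.le he1
    refine ⟨hs, ht, fun s' hs' => ?_, fun t' ht' => ?_⟩
    · have := hs'.isProbabilityMeasure
      linarith [G.payoffA_le s' (G.IUB (XB / XA)),
        G.payoffA_nonneg (G.IUA (XB / XA)) (G.IUB (XB / XA))]
    · have := ht'.isProbabilityMeasure
      linarith [G.payoffB_le (G.IUA (XB / XA)) t', hG.WB_eq,
        G.payoffB_nonneg (G.IUA (XB / XA)) (G.IUB (XB / XA))]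
  have hdevA : ∀ s', IsMixedStrategy XA s' → G.payoffA s' (G.IUB (XB / XA)) ≤
      G.WA * (XA / XB / 2 * (1 + e)) := fun s' hs' => by
    refine G.payoffA_le_of_forall hs' fun x hx => ?_
    rw [IUB, hG.distB_eq]
    refine (G.sum_wA_mul_map_rescale_le le_rfl zero_le_one (by ring) he0 he1.le
      (fun i => ?_) hx).trans_eq ?_
    -- The smallness condition is stated for the smaller budget `XA`, hence holds for `XB` too.
    · linarith [hbe i, mul_le_mul_of_nonneg_left hAB he0]
    · field_simp
      ring
  have hdevB : ∀ t', IsMixedStrategy XB t' → G.payoffB (G.IUA (XB / XA)) t' ≤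
      G.WA * (1 - XA / XB + XA / XB / 2 * (1 + e)) := fun t' ht' => by
    refine G.payoffB_le_of_forall ht' fun x hx => ?_
    rw [IUA, hG.distA_eq, hG.wB_eq]
    refine (G.sum_wA_mul_map_rescale_le (by linarith) (by linarith) ?_ he0 he1.le
      (fun i => ?_) hx).trans_eq ?_
    · field_simp
      ring
    · linarith [hbe i]
    · field_simp
      ring
  -- With `hconst`, this gap converts the bound on one player's payoff at the profile into a lower
  -- bound on the other's.
  have hgap : G.WA * (XA / XB / 2 * (1 + e)) +
      G.WA * (1 - XA / XB + XA / XB / 2 * (1 + e)) ≤ G.WA + e * G.WA := by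
    have : XA / XB * (e * G.WA) ≤ e * G.WA :=
      mul_le_of_le_one_left (mul_nonneg he0 hW.le) hr1
    linarith
  exact ⟨hs, ht, fun s' hs' => by linarith [hdevA s' hs', hdevB _ ht],
    fun t' ht' => by linarith [hdevB t' ht', hdevA _ hs]⟩

theorem vA_le_of_valuesBetween {G : GCBGame n XA XB} {wlo whi : ℝ} (hwlo : 0 < wlo)
    (hG : G.ValuesBetween wlo whi) (i : Fin n) : G.vA i ≤ whi / (n * wlo) := by
  have hn : (0 : ℝ) < n := by exact_mod_cast (show 0 < n by linarith [G.three_le])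
  have hW : n * wlo ≤ G.WA := by
    have := Finset.card_nsmul_le_sum Finset.univ G.wA wlo fun j _ => (hG j).1.1
    simpa [WA] using this
  have := (G.wA_pos i).le.trans (hG i).1.2
  exact div_le_div₀ this (hG i).1.2 (by positivity) hW

end GCBGame

/-! ### The error rate and the conclusion -/

theorem isSoftO_div_add_one (C : ℝ) :
    IsSoftO (fun n : ℕ => C / (n + 1)) fun n : ℕ => (n : ℝ) ^ (-(1 / 2) : ℝ) := by
  refine ⟨0, IsBigO.of_bound |C| ?_⟩
  filter_upwards [eventually_ge_atTop 1] with n hn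
  have hn1 : (1 : ℝ) ≤ n := by exact_mod_cast hn
  rw [pow_zero, mul_one, Real.norm_eq_abs, abs_div, Real.norm_of_nonneg (by positivity),
    abs_of_pos (by positivity : (0 : ℝ) < n + 1), div_eq_mul_inv]
  gcongr
  calc ((n : ℝ) + 1)⁻¹ ≤ (n : ℝ)⁻¹ := by gcongr; linarith
    _ = (n : ℝ) ^ (-1 : ℝ) := (Real.rpow_neg_one _).symm
    _ ≤ (n : ℝ) ^ (-(1 / 2) : ℝ) := Real.rpow_le_rpow_of_exponent_le hn1 (by norm_num)

theorem mainTheorem3 (XA XB wlo whi : ℝ) (hXA : 0 < XA) (hXAB : XA ≤ XB)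
    (hwlo : 0 < wlo) (hw : wlo ≤ whi) :
    ∃ ε : ℕ → ℝ, (∀ n, 0 < ε n) ∧
      IsSoftO ε (fun n : ℕ => (n : ℝ) ^ (-(1 / 2) : ℝ)) ∧
      ∀ (n : ℕ) (G : GCBGame n XA XB), G.IsConstantSum → G.ValuesBetween wlo whi →
        G.gammaSolutions = {XB / XA} ∧
        G.IsApproxEquilibrium (ε n * G.W) (G.IUA (XB / XA)) (G.IUB (XB / XA)) := by
  have hXB : 0 < XB := hXA.trans_le hXAB
  have hwhi : 0 < whi := hwlo.trans_le hw
  -- Shares are at most `whi / (n * wlo)`, giving `4 * XB * whi / (wlo * XA * n)`; the denominator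
  -- `n + 1 ≤ 2 * n` keeps the error positive at `n = 0` and doubles the constant.
  refine ⟨fun n => 8 * XB * whi / (wlo * XA) / (n + 1), fun n => by positivity,
    isSoftO_div_add_one _, fun n G hG hV => ⟨hG.gammaSolutions_eq,
      hG.isApproxEquilibrium_IU (by positivity) fun i => ?_⟩⟩
  have hn : (1 : ℝ) ≤ n := by exact_mod_cast (show 1 ≤ n by linarith [G.three_le])
  have hn0 : (0 : ℝ) < n := by linarith
  calc 4 * XB * G.vA i ≤ 4 * XB * (whi / (n * wlo)) := by
        gcongr
        exact GCBGame.vA_le_of_valuesBetween hwlo hV i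
    _ = 8 * XB * whi / wlo / (2 * n) := by
        field_simp
        ring
    _ ≤ 8 * XB * whi / wlo / (n + 1) := by
        gcongr
        linarith
    _ = 8 * XB * whi / (wlo * XA) / (n + 1) * XA := by
        field_simp
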